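/- Consider second-order logic with equality over a single sort, with no function symbols, no relation symbols and no background theory: terms are built from first-order variables by function variables (of any arity, $0$ included), and a structure consists of a nonempty universe together with an interpretation of the variables in it, where a quantified function variable of arity $k$ ranges over all functions from $k$-tuples of elements of the universe to the universe. The satisfiability problem for sentences of the form \[ (\exists x_1)\cdots(\exists x_m)\,(\exists F_1)\cdots(\exists F_n)\,(\forall y_1)\cdots(\forall y_k)\,\psi , \] where $m,n,k\ge 0$, the $x_i$ and $y_i$ are first-order variables, the $F_i$ are function variables and $\psi$ is quantifier-free, is undecidable: there is no algorithm that, given (the Gödel number of) such a sentence, decides whether it holds in some structure. -/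

import Mathlib

namespace UnsortedSO

/-! Second-order logic over a signature with one sort and without function or relation symbols:
all functions and relations that occur are second-order variables. -/

/-- A function variable, given by its arity (zero is allowed) and its name.
There are countably many of each arity. -/
abbrev FnVar := ℕ × ℕ

/-- The arity of a function variable. -/
abbrev FnVar.arity (F : FnVar) : ℕ := F.1

/-- A relation variable `(k, i)` has arity `k + 1` and name `i`. -/
abbrev RelVar := ℕ × ℕ

/-- The arity of a relation variable, which is positive. -/
abbrev RelVar.arity (R : RelVar) : ℕ := R.1 + 1

/-- Terms: first-order variables and applications of function variables. -/
inductive Term : Type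
  | var (x : ℕ) : Term
  | app (F : FnVar) (ts : Fin F.arity → Term) : Term

/-- Formulas of second-order logic. -/
inductive Formula : Type
  | falsum : Formula
  | imp (φ χ : Formula) : Formula
  | eq (s t : Term) : Formula
  | rel (R : RelVar) (ts : Fin R.arity → Term) : Formula
  | ex (x : ℕ) (φ : Formula) : Formula
  | exFn (F : FnVar) (φ : Formula) : Formula
  | exRel (R : RelVar) (φ : Formula) : Formula

/-! ### Semantics -/

/-- An interpretation of all variables in the universe `M` (which is then nonempty).
As there are no symbols in the signature, a structure is a universe with such an interpretation. -/
structure Interp (M : Type) where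
  var : ℕ → M
  fn : (F : FnVar) → (Fin F.arity → M) → M
  rel : (R : RelVar) → (Fin R.arity → M) → Prop

/-- The value of a term. -/
def Term.val {M : Type} (I : Interp M) : Term → M
  | .var x => I.var x
  | .app F ts => I.fn F (fun i => (ts i).val I)

/-- The satisfaction relation, with the full semantics of the second-order quantifiers. -/
def Formula.Holds {M : Type} : Interp M → Formula → Prop
  | _, .falsum => False
  | I, .imp φ χ => φ.Holds I → χ.Holds I
  | I, .eq s t => s.val I = t.val I
  | I, .rel R ts => I.rel R (fun i => (ts i).val I)
  | I, .ex x φ => ∃ a : M, φ.Holds { I with var := Function.update I.var x a }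
  | I, .exFn F φ =>
      ∃ f : (Fin F.arity → M) → M, φ.Holds { I with fn := Function.update I.fn F f }
  | I, .exRel R φ =>
      ∃ r : (Fin R.arity → M) → Prop, φ.Holds { I with rel := Function.update I.rel R r }

/-- A formula is satisfiable if it holds in some structure. -/
def Formula.Satisfiable (φ : Formula) : Prop :=
  ∃ (M : Type) (I : Interp M), φ.Holds I

/-! ### Sentences and the prefix class -/

/-- First-order variables of a term. -/
def Term.vars : Term → Set ℕ
  | .var x => {x}
  | .app _ ts => ⋃ i, (ts i).vars

/-- Function variables of a term. -/
def Term.fnVars : Term → Set FnVar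
  | .var _ => ∅
  | .app F ts => {F} ∪ ⋃ i, (ts i).fnVars

/-- Free first-order variables. -/
def Formula.freeVars : Formula → Set ℕ
  | .falsum => ∅
  | .imp φ χ => φ.freeVars ∪ χ.freeVars
  | .eq s t => s.vars ∪ t.vars
  | .rel _ ts => ⋃ i, (ts i).vars
  | .ex x φ => φ.freeVars \ {x}
  | .exFn _ φ => φ.freeVars
  | .exRel _ φ => φ.freeVars

/-- Free function variables. -/
def Formula.freeFnVars : Formula → Set FnVar
  | .falsum => ∅
  | .imp φ χ => φ.freeFnVars ∪ χ.freeFnVars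
  | .eq s t => s.fnVars ∪ t.fnVars
  | .rel _ ts => ⋃ i, (ts i).fnVars
  | .ex _ φ => φ.freeFnVars
  | .exFn F φ => φ.freeFnVars \ {F}
  | .exRel _ φ => φ.freeFnVars

/-- Free relation variables. -/
def Formula.freeRelVars : Formula → Set RelVar
  | .falsum => ∅
  | .imp φ χ => φ.freeRelVars ∪ χ.freeRelVars
  | .eq _ _ => ∅
  | .rel R _ => {R}
  | .ex _ φ => φ.freeRelVars
  | .exFn _ φ => φ.freeRelVars
  | .exRel R φ => φ.freeRelVars \ {R}

/-- A sentence has no free variables of any of the three kinds. -/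
def Formula.IsSentence (φ : Formula) : Prop :=
  φ.freeVars = ∅ ∧ φ.freeFnVars = ∅ ∧ φ.freeRelVars = ∅

/-- No quantifier of any kind occurs. -/
def Formula.QuantifierFree : Formula → Prop
  | .falsum => True
  | .imp φ χ => φ.QuantifierFree ∧ χ.QuantifierFree
  | .eq _ _ => True
  | .rel _ _ => True
  | .ex _ _ => False
  | .exFn _ _ => False
  | .exRel _ _ => False

/-- Negation. -/
def Formula.neg (φ : Formula) : Formula := .imp φ .falsum

/-- First-order universal quantification. -/
def Formula.all (x : ℕ) (φ : Formula) : Formula := .neg (.ex x (.neg φ))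

/-- The formulas `(∃ x₁ … xₘ) (∃ F₁ … Fₙ) (∀ y₁ … yₖ) ψ` with `ψ` quantifier-free. -/
def Formula.IsExExFnAll (φ : Formula) : Prop :=
  ∃ (xs : List ℕ) (Fs : List FnVar) (ys : List ℕ) (ψ : Formula),
    ψ.QuantifierFree ∧ φ = xs.foldr .ex (Fs.foldr .exFn (ys.foldr .all ψ))

/-! ### Gödel numbers, through which formulas are given to an algorithm -/

/-- The Gödel number of a term. -/
def Term.code : Term → ℕ
  | .var x => Nat.pair 0 x
  | .app F ts =>
      Nat.pair 1 (Nat.pair (Nat.pair F.1 F.2)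
        (Encodable.encode (List.ofFn fun i => (ts i).code)))

/-- The Gödel number of a formula. -/
def Formula.code : Formula → ℕ
  | .falsum => Nat.pair 0 0
  | .imp φ χ => Nat.pair 1 (Nat.pair φ.code χ.code)
  | .eq s t => Nat.pair 2 (Nat.pair s.code t.code)
  | .rel R ts =>
      Nat.pair 3 (Nat.pair (Nat.pair R.1 R.2)
        (Encodable.encode (List.ofFn fun i => (ts i).code)))
  | .ex x φ => Nat.pair 4 (Nat.pair x φ.code)
  | .exFn F φ => Nat.pair 5 (Nat.pair (Nat.pair F.1 F.2) φ.code)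
  | .exRel R φ => Nat.pair 6 (Nat.pair (Nat.pair R.1 R.2) φ.code)

theorem Term.code_injective : Function.Injective Term.code := by
  intro s
  induction s with
  | var x =>
    intro t h
    cases t <;> simp_all [Term.code, Nat.pair_eq_pair]
  | app F ts ih =>
    intro t h
    cases t with
    | var y => simp [Term.code, Nat.pair_eq_pair] at h
    | app G us =>
      obtain ⟨k, i⟩ := F
      obtain ⟨l, j⟩ := G
      simp only [Term.code, Nat.pair_eq_pair, true_and] at h
      obtain ⟨⟨rfl, rfl⟩, h⟩ := h
      have h' := List.ofFn_injective (Encodable.encode_injective h)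
      congr 1
      funext a
      exact ih a (congrFun h' a)

/-- Different formulas have different Gödel numbers. -/
theorem Formula.code_injective : Function.Injective Formula.code := by
  intro φ
  induction φ with
  | rel R ts =>
    intro χ h
    cases χ with
    | rel S us =>
      obtain ⟨k, i⟩ := R
      obtain ⟨l, j⟩ := S
      simp only [Formula.code, Nat.pair_eq_pair, true_and] at h
      obtain ⟨⟨rfl, rfl⟩, h⟩ := h
      have h' := List.ofFn_injective (Encodable.encode_injective h)
      congr 1
      funext a
      exact Term.code_injective (congrFun h' a)
    | _ => simp [Formula.code, Nat.pair_eq_pair] at h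
  | falsum =>
    intro χ h
    cases χ <;> simp_all [Formula.code, Nat.pair_eq_pair]
  | eq s t =>
    intro χ h
    cases χ <;> simp [Formula.code, Nat.pair_eq_pair] at h
    rw [Term.code_injective h.1, Term.code_injective h.2]
  | imp φ₁ φ₂ ih₁ ih₂ =>
    intro χ h
    cases χ <;> simp [Formula.code, Nat.pair_eq_pair] at h
    rw [ih₁ h.1, ih₂ h.2]
  | ex x φ ih =>
    intro χ h
    cases χ <;> simp [Formula.code, Nat.pair_eq_pair] at h
    rw [h.1, ih h.2]
  | exFn F φ ih =>
    intro χ h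
    cases χ <;> simp [Formula.code, Nat.pair_eq_pair] at h
    rw [Prod.ext h.1.1 h.1.2, ih h.2]
  | exRel R φ ih =>
    intro χ h
    cases χ <;> simp [Formula.code, Nat.pair_eq_pair] at h
    rw [Prod.ext h.1.1 h.1.2, ih h.2]

end UnsortedSO

/-! Non-halting reduces to satisfiability. Let g(⟨k, c⟩) encode the result of running program `c` on
input 0 with bound k, with 0 for "no result yet"; g is primitive recursive, and `c` halts iff g(⟨k,
c⟩) ≠ 0 for some k.

Once addition, multiplication and pairing are axiomatized (`arith`), the values of a primitive
recursive function on numerals are forced by finitely many universally quantified equations in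
function variables (`exists_equations`). The sentence for `c` says that functions exist which
satisfy these equations and, for all x, g(⟨x, c⟩) = 0 and 0 ≠ s x. If `c` does not halt, the natural
numbers (`std`) are a model. If it halts within bound k, the equations make g(⟨k, c⟩) a successor
numeral, contradicting g(⟨x, c⟩) = 0 at x = k. Models may be nonstandard and distinct numerals may
coincide: only 0 ≠ s x is needed.

Only the numeral of `c` varies from sentence to sentence, so the Gödel number is primitive recursive
in `c` (`exists_reduction`). -/

namespace UnsortedSO

open Nat.Partrec (Code)

/-! ### Terms over constants, unary and binary function variables -/

/-- The constant zero, a nullary function variable. -/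
def Term.zero : Term := .app (0, 0) Fin.elim0

/-- Application of the `i`-th unary function variable. -/
def Term.app₁ (i : ℕ) (t : Term) : Term := .app (1, i) fun _ => t

/-- Application of the `i`-th binary function variable. -/
def Term.app₂ (i : ℕ) (s t : Term) : Term := .app (2, i) ![s, t]

/-- The index of the unary function variable for the function computed by `c`. -/
def symb (c : Code) : ℕ := Encodable.encode c

/-- The successor term. -/
def Term.succ (t : Term) : Term := .app₁ (symb .succ) t

/-- The pairing term. -/
def Term.pair (s t : Term) : Term := .app₂ 0 s t

/-- The addition term. -/
def Term.add (s t : Term) : Term := .app₂ 1 s t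

/-- The multiplication term. -/
def Term.mul (s t : Term) : Term := .app₂ 2 s t

/-- The numeral of a natural number. -/
def Term.num : ℕ → Term
  | 0 => .zero
  | n + 1 => .succ (.num n)

section

variable {M : Type} (I : Interp M)

/-- The value of the constant zero. -/
def Interp.zero : M := I.fn (0, 0) Fin.elim0

/-- The interpretation of a unary function variable. -/
def Interp.app₁ (i : ℕ) (a : M) : M := I.fn (1, i) fun _ => a

/-- The interpretation of a binary function variable. -/
def Interp.app₂ (i : ℕ) (a b : M) : M := I.fn (2, i) ![a, b]

/-- The element denoted by a numeral. -/
def Interp.num : ℕ → M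
  | 0 => I.zero
  | n + 1 => I.app₁ (symb .succ) (Interp.num n)

/-- The interpretation with the variables `0, 1, 2` set to `a, b, c`. -/
def Interp.assign (a b c : M) : Interp M :=
  { I with var := Function.update (Function.update (Function.update I.var 0 a) 1 b) 2 c }

@[simp] theorem Interp.assign_var_zero (a b c : M) : (I.assign a b c).var 0 = a := rfl
@[simp] theorem Interp.assign_var_one (a b c : M) : (I.assign a b c).var 1 = b := rfl
@[simp] theorem Interp.assign_zero (a b c : M) : (I.assign a b c).zero = I.zero := rfl
@[simp] theorem Interp.assign_app₁ (a b c : M) : (I.assign a b c).app₁ = I.app₁ := rfl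
@[simp] theorem Interp.assign_app₂ (a b c : M) : (I.assign a b c).app₂ = I.app₂ := rfl
@[simp] theorem Interp.assign_num (a b c : M) : (I.assign a b c).num = I.num := by
  funext n
  induction n with
  | zero => rfl
  | succ n ih => simp [Interp.num, ih]

@[simp] theorem Term.val_var (x : ℕ) : (Term.var x).val I = I.var x := rfl

@[simp] theorem Term.val_zero : Term.zero.val I = I.zero := by
  simp only [Term.zero, Interp.zero, Term.val]
  congr 1
  funext i
  exact i.elim0

@[simp] theorem Term.val_app₁ (i : ℕ) (t : Term) :
    (Term.app₁ i t).val I = I.app₁ i (t.val I) := rfl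

@[simp] theorem Term.val_app₂ (i : ℕ) (s t : Term) :
    (Term.app₂ i s t).val I = I.app₂ i (s.val I) (t.val I) := by
  simp only [Term.app₂, Interp.app₂, Term.val]
  congr 1
  funext j
  match j with
  | 0 => rfl
  | 1 => rfl

@[simp] theorem Term.val_num (n : ℕ) : (Term.num n).val I = I.num n := by
  induction n with
  | zero => simp [Term.num, Interp.num]
  | succ n ih => simp [Term.num, Interp.num, Term.succ, ih]

end

@[simp] theorem Term.vars_zero : Term.zero.vars = ∅ :=
  Set.iUnion_of_empty (ι := Fin 0) _

@[simp] theorem Term.vars_app₁ (i : ℕ) (t : Term) : (Term.app₁ i t).vars = t.vars :=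
  Set.iUnion_const (ι := Fin 1) t.vars

@[simp] theorem Term.vars_app₂ (i : ℕ) (s t : Term) :
    (Term.app₂ i s t).vars = s.vars ∪ t.vars := by
  ext x
  simp only [Term.app₂, Term.vars, Set.mem_iUnion]
  exact Fin.exists_fin_two (p := fun j => x ∈ ((![s, t] : Fin 2 → Term) j).vars)

@[simp] theorem Term.vars_num (n : ℕ) : (Term.num n).vars = ∅ := by
  induction n with
  | zero => simp [Term.num]
  | succ n ih => simp [Term.num, Term.succ, ih]

theorem Term.finite_fnVars (t : Term) : t.fnVars.Finite := by
  induction t with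
  | var x => exact Set.finite_empty
  | app F ts ih => exact (Set.finite_singleton F).union (Set.finite_iUnion ih)

@[simp] theorem Term.fnVars_app₁ (i : ℕ) (t : Term) :
    (Term.app₁ i t).fnVars = {(1, i)} ∪ t.fnVars :=
  congrArg ({((1, i) : FnVar)} ∪ ·) (Set.iUnion_const (ι := Fin 1) t.fnVars)

@[simp] theorem Term.fnVars_app₂ (i : ℕ) (s t : Term) :
    (Term.app₂ i s t).fnVars = {(2, i)} ∪ (s.fnVars ∪ t.fnVars) := by
  refine congrArg ({((2, i) : FnVar)} ∪ ·) ?_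
  ext x
  simp only [Set.mem_iUnion]
  exact Fin.exists_fin_two (p := fun j => x ∈ ((![s, t] : Fin 2 → Term) j).fnVars)

/-- Allows one fixed list of quantified function variables to serve for all programs. -/
theorem Term.fnVars_num_subset (n : ℕ) : (Term.num n).fnVars ⊆ (Term.succ .zero).fnVars := by
  induction n with
  | zero =>
    rw [Term.succ, Term.fnVars_app₁]
    exact Set.subset_union_right
  | succ n ih =>
    simp only [Term.num, Term.succ, Term.fnVars_app₁] at ih ⊢
    exact Set.union_subset Set.subset_union_left ih

/-! ### Lists of equations -/

/-- The list of equations holds universally, as far as the variables `0, 1, 2` are concerned. -/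
def Interp.Models {M : Type} (I : Interp M) (E : List (Term × Term)) : Prop :=
  ∀ e ∈ E, ∀ a b c : M, e.1.val (I.assign a b c) = e.2.val (I.assign a b c)

theorem Interp.models_append {M : Type} {I : Interp M} {E E' : List (Term × Term)} :
    I.Models (E ++ E') ↔ I.Models E ∧ I.Models E' := by
  simp [Interp.Models, or_imp, forall_and]

/-- Only the variables `0, 1, 2` occur in the equations. -/
def ThreeVars (E : List (Term × Term)) : Prop :=
  ∀ e ∈ E, e.1.vars ∪ e.2.vars ⊆ {0, 1, 2}

theorem ThreeVars.append {E E' : List (Term × Term)} (h : ThreeVars E) (h' : ThreeVars E') :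
    ThreeVars (E ++ E') := by
  simp only [ThreeVars, List.mem_append]
  rintro e (he | he)
  exacts [h e he, h' e he]

open Classical in
/-- The total function agreeing with the `i`-th partial recursive function where the latter is
defined. -/
noncomputable def totalFn (i n : ℕ) : ℕ :=
  ((Denumerable.ofNat Code i).eval n).toOption.getD 0

theorem totalFn_symb {c : Code} {f : ℕ → ℕ} (h : c.eval = (f : ℕ →. ℕ)) : totalFn (symb c) = f := by
  funext n
  simp [totalFn, symb, h]

/-- The standard interpretation in the natural numbers. -/
noncomputable def std : Interp ℕ where
  var _ := 0
  fn
    | (1, i), v => totalFn i (v 0)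
    | (2, 0), v => Nat.pair (v 0) (v 1)
    | (2, 1), v => v 0 + v 1
    | (2, 2), v => v 0 * v 1
    | _, _ => 0
  rel _ _ := False

@[simp] theorem std_zero : std.zero = 0 := rfl
theorem std_app₁ {c : Code} {f : ℕ → ℕ} (h : c.eval = (f : ℕ →. ℕ)) : std.app₁ (symb c) = f :=
  totalFn_symb h
@[simp] theorem std_succ : std.app₁ (symb .succ) = Nat.succ := std_app₁ rfl
@[simp] theorem std_left : std.app₁ (symb .left) = fun n => n.unpair.1 := std_app₁ rfl
@[simp] theorem std_right : std.app₁ (symb .right) = fun n => n.unpair.2 := std_app₁ rfl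
@[simp] theorem std_pair (a b : ℕ) : std.app₂ 0 a b = Nat.pair a b := rfl
@[simp] theorem std_add (a b : ℕ) : std.app₂ 1 a b = a + b := rfl
@[simp] theorem std_mul (a b : ℕ) : std.app₂ 2 a b = a * b := rfl
@[simp] theorem std_num (n : ℕ) : std.num n = n := by
  induction n with
  | zero => rfl
  | succ n ih => simp [Interp.num, ih]

/-- Equations for addition, multiplication, pairing and the projections. -/
def arith : List (Term × Term) :=
  [(.add (.var 0) .zero, .var 0),
   (.add (.var 0) (.succ (.var 1)), .succ (.add (.var 0) (.var 1))),
   (.mul (.var 0) .zero, .zero),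
   (.mul (.var 0) (.succ (.var 1)), .add (.mul (.var 0) (.var 1)) (.var 0)),
   (.pair (.var 0) (.add (.var 0) (.succ (.var 1))),
    .add (.mul (.add (.var 0) (.succ (.var 1))) (.add (.var 0) (.succ (.var 1)))) (.var 0)),
   (.pair (.add (.var 0) (.var 1)) (.var 0),
    .add (.add (.mul (.add (.var 0) (.var 1)) (.add (.var 0) (.var 1)))
      (.add (.var 0) (.var 1))) (.var 0)),
   (.app₁ (symb .left) (.pair (.var 0) (.var 1)), .var 0),
   (.app₁ (symb .right) (.pair (.var 0) (.var 1)), .var 1)]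

theorem threeVars_arith : ThreeVars arith := by
  simp [ThreeVars, arith, Term.add, Term.mul, Term.pair, Term.succ, Term.vars, Set.subset_def]
  omega

theorem std_models_arith : std.Models arith := by
  simp [Interp.Models, arith, Term.add, Term.mul, Term.pair, Term.succ, Nat.pair,
    ← Nat.add_assoc, Nat.mul_add]
  exact ⟨fun a b => congrArg Prod.fst (Nat.unpair_pair a b),
    fun a b => congrArg Prod.snd (Nat.unpair_pair a b)⟩

/-! ### Values on numerals forced by the arithmetic equations -/

section

variable {M : Type} {I : Interp M}

theorem num_add (h : I.Models arith) (a b : ℕ) :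
    I.app₂ 1 (I.num a) (I.num b) = I.num (a + b) := by
  simp only [Interp.Models, arith, List.forall_mem_cons, Term.add, Term.succ, Term.val_app₂,
    Term.val_app₁, Term.val_var, Term.val_zero, Interp.assign_app₁, Interp.assign_app₂,
    Interp.assign_var_zero, Interp.assign_var_one, Interp.assign_zero] at h
  induction b with
  | zero => exact h.1 _ (I.num 0) (I.num 0)
  | succ b ih => exact (h.2.1 _ _ (I.num 0)).trans (congrArg _ ih)

theorem num_mul (h : I.Models arith) (a b : ℕ) :
    I.app₂ 2 (I.num a) (I.num b) = I.num (a * b) := by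
  have h' := h
  simp only [Interp.Models, arith, List.forall_mem_cons, Term.add, Term.mul, Term.succ,
    Term.val_app₂, Term.val_app₁, Term.val_var, Term.val_zero, Interp.assign_app₁,
    Interp.assign_app₂, Interp.assign_var_zero, Interp.assign_var_one, Interp.assign_zero] at h'
  induction b with
  | zero => exact h'.2.2.1 _ (I.num 0) (I.num 0)
  | succ b ih =>
    rw [Nat.mul_succ, ← num_add h (a * b), ← ih]
    exact h'.2.2.2.1 _ _ (I.num 0)

/-- `Nat.pair a b` is b² + a if a < b, and a² + a + b otherwise. The two pairing equations of
`arith` avoid the case distinction by parametrizing the cases as (x, x + s y) and (x + y, x). -/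
theorem num_pair (h : I.Models arith) (a b : ℕ) :
    I.app₂ 0 (I.num a) (I.num b) = I.num (Nat.pair a b) := by
  have h' := h
  simp only [Interp.Models, arith, List.forall_mem_cons, Term.add, Term.mul, Term.succ, Term.pair,
    Term.val_app₂, Term.val_app₁, Term.val_var, Term.val_zero, Interp.assign_app₁,
    Interp.assign_app₂, Interp.assign_var_zero, Interp.assign_var_one, Interp.assign_zero] at h'
  obtain hab | hab := lt_or_ge a b
  · obtain ⟨d, rfl⟩ := Nat.exists_eq_add_of_lt hab
    have := h'.2.2.2.2.1 (I.num a) (I.num d) (I.num 0)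
    change I.app₂ 0 _ (I.app₂ 1 _ (I.num (d + 1))) = I.app₂ 1 (I.app₂ 2
      (I.app₂ 1 _ (I.num (d + 1))) (I.app₂ 1 _ (I.num (d + 1)))) _ at this
    rw [num_add h, num_mul h, num_add h] at this
    rw [Nat.add_assoc, this, Nat.pair, if_pos (by omega)]
  · obtain ⟨d, rfl⟩ := Nat.exists_eq_add_of_le hab
    have := h'.2.2.2.2.2.1 (I.num b) (I.num d) (I.num 0)
    rw [num_add h, num_mul h, num_add h, num_add h] at this
    rw [this, Nat.pair, if_neg (by omega)]

theorem left_pair (h : I.Models arith) (a b : M) :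
    I.app₁ (symb .left) (I.app₂ 0 a b) = a := by
  simpa [Term.pair] using h (.app₁ (symb .left) (.pair (.var 0) (.var 1)), .var 0)
    (by simp [arith]) a b a

theorem right_pair (h : I.Models arith) (a b : M) :
    I.app₁ (symb .right) (I.app₂ 0 a b) = b := by
  simpa [Term.pair] using h (.app₁ (symb .right) (.pair (.var 0) (.var 1)), .var 1)
    (by simp [arith]) a b a

/-- Pairing is onto the numerals, so equations stated for pairs apply to every numeral. -/
theorem num_eq_pair (h : I.Models arith) (n : ℕ) :
    I.num n = I.app₂ 0 (I.num n.unpair.1) (I.num n.unpair.2) := by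
  rw [num_pair h, Nat.pair_unpair]

end

/-- Every primitive recursive function is defined by finitely many equations that are true in the
natural numbers and determine its values on numerals. -/
theorem exists_equations {f : ℕ → ℕ} (hf : Nat.Primrec f) :
    ∃ (c : Code) (E : List (Term × Term)), std.app₁ (symb c) = f ∧ ThreeVars E ∧ std.Models E ∧
      ∀ (M : Type) (I : Interp M), I.Models arith → I.Models E →
        ∀ n, I.app₁ (symb c) (I.num n) = I.num (f n) := by
  -- Naming variables by codes fixes their meaning in `std` in advance; equation lists for different
  -- subfunctions can then be joined without renaming.
  obtain ⟨c, hc⟩ := Code.exists_code.1 (Nat.Partrec.of_primrec hf)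
  have hstd := std_app₁ hc
  induction hf generalizing c with
  | zero =>
    refine ⟨c, [(.app₁ (symb c) (.var 0), .zero)], hstd, ?_, ?_, fun M I _ h n => ?_⟩
    · simp [ThreeVars, Term.vars]
    · simp [Interp.Models, hstd]
    · exact (h _ (List.mem_singleton_self _) (I.num n) I.zero I.zero).trans (by simp [Interp.num])
  | succ =>
    -- The given code is dropped in favour of `.succ`, whose variable builds the numerals; likewise
    -- `.left` and `.right` below are already governed by `arith`.
    exact ⟨.succ, [], std_succ, by simp [ThreeVars], by simp [Interp.Models],
      fun M I _ _ n => rfl⟩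
  | left =>
    refine ⟨.left, [], std_left, by simp [ThreeVars], by simp [Interp.Models],
      fun M I h _ n => ?_⟩
    rw [num_eq_pair h, left_pair h]
  | right =>
    refine ⟨.right, [], std_right, by simp [ThreeVars], by simp [Interp.Models],
      fun M I h _ n => ?_⟩
    rw [num_eq_pair h, right_pair h]
  | @pair f g hf hg ihf ihg =>
    obtain ⟨cf, hcf⟩ := Code.exists_code.1 (Nat.Partrec.of_primrec hf)
    obtain ⟨cg, hcg⟩ := Code.exists_code.1 (Nat.Partrec.of_primrec hg)
    obtain ⟨cf, E, sf, vf, mf, nf⟩ := ihf cf hcf (std_app₁ hcf)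
    obtain ⟨cg, E', sg, vg, mg, ng⟩ := ihg cg hcg (std_app₁ hcg)
    refine ⟨c, (.app₁ (symb c) (.var 0), .pair (.app₁ (symb cf) (.var 0))
      (.app₁ (symb cg) (.var 0))) :: (E ++ E'), hstd, ?_, ?_, fun M I h h' n => ?_⟩
    · exact List.forall_mem_cons.2 ⟨by simp [Term.vars, Term.pair], vf.append vg⟩
    · exact List.forall_mem_cons.2 ⟨by simp [hstd, sf, sg, Term.pair],
        Interp.models_append.2 ⟨mf, mg⟩⟩
    · obtain ⟨h₁, h₂⟩ := List.forall_mem_cons.1 h'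
      obtain ⟨h₂, h₃⟩ := Interp.models_append.1 h₂
      have := h₁ (I.num n) I.zero I.zero
      simp only [Term.pair, Term.val_app₁, Term.val_app₂, Term.val_var, Interp.assign_app₁,
        Interp.assign_app₂, Interp.assign_var_zero] at this
      rw [this, nf M I h h₂, ng M I h h₃, num_pair h]
  | @comp f g hf hg ihf ihg =>
    obtain ⟨cf, hcf⟩ := Code.exists_code.1 (Nat.Partrec.of_primrec hf)
    obtain ⟨cg, hcg⟩ := Code.exists_code.1 (Nat.Partrec.of_primrec hg)
    obtain ⟨cf, E, sf, vf, mf, nf⟩ := ihf cf hcf (std_app₁ hcf)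
    obtain ⟨cg, E', sg, vg, mg, ng⟩ := ihg cg hcg (std_app₁ hcg)
    refine ⟨c, (.app₁ (symb c) (.var 0), .app₁ (symb cf) (.app₁ (symb cg) (.var 0))) :: (E ++ E'),
      hstd, ?_, ?_, fun M I h h' n => ?_⟩
    · exact List.forall_mem_cons.2 ⟨by simp [Term.vars], vf.append vg⟩
    · exact List.forall_mem_cons.2 ⟨by simp [hstd, sf, sg],
        Interp.models_append.2 ⟨mf, mg⟩⟩
    · obtain ⟨h₁, h₂⟩ := List.forall_mem_cons.1 h'
      obtain ⟨h₂, h₃⟩ := Interp.models_append.1 h₂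
      have := h₁ (I.num n) I.zero I.zero
      simp only [Term.val_app₁, Term.val_var, Interp.assign_app₁,
        Interp.assign_var_zero] at this
      rw [this, ng M I h h₃, nf M I h h₂]
  | @prec f g hf hg ihf ihg =>
    obtain ⟨cf, hcf⟩ := Code.exists_code.1 (Nat.Partrec.of_primrec hf)
    obtain ⟨cg, hcg⟩ := Code.exists_code.1 (Nat.Partrec.of_primrec hg)
    obtain ⟨cf, E, sf, vf, mf, nf⟩ := ihf cf hcf (std_app₁ hcf)
    obtain ⟨cg, E', sg, vg, mg, ng⟩ := ihg cg hcg (std_app₁ hcg)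
    refine ⟨c, (.app₁ (symb c) (.pair (.var 0) .zero), .app₁ (symb cf) (.var 0)) ::
      (.app₁ (symb c) (.pair (.var 0) (.succ (.var 1))),
        .app₁ (symb cg) (.pair (.var 0) (.pair (.var 1)
          (.app₁ (symb c) (.pair (.var 0) (.var 1)))))) :: (E ++ E'),
      hstd, ?_, ?_, fun M I h h' n => ?_⟩
    · exact List.forall_mem_cons.2 ⟨by simp [Term.vars, Term.pair], List.forall_mem_cons.2
        ⟨by simp [Term.vars, Term.pair, Term.succ, Set.subset_def], vf.append vg⟩⟩
    · exact List.forall_mem_cons.2 ⟨by simp [hstd, sf, Term.pair], List.forall_mem_cons.2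
        ⟨by simp [hstd, sg, Term.pair, Term.succ], Interp.models_append.2 ⟨mf, mg⟩⟩⟩
    · obtain ⟨h₁, h₂⟩ := List.forall_mem_cons.1 h'
      obtain ⟨h₂, h₃⟩ := List.forall_mem_cons.1 h₂
      obtain ⟨h₃, h₄⟩ := Interp.models_append.1 h₃
      simp only [Term.pair, Term.succ, Term.val_app₁, Term.val_app₂, Term.val_var, Term.val_zero,
        Interp.assign_app₁, Interp.assign_app₂, Interp.assign_var_zero, Interp.assign_var_one,
        Interp.assign_zero] at h₁ h₂
      -- With the argument written as a pair of numerals, the recursion equations apply by induction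
      -- on the second component.
      rw [num_eq_pair h, Nat.unpaired]
      generalize n.unpair.1 = a
      generalize n.unpair.2 = b
      induction b with
      | zero => exact (h₁ _ I.zero I.zero).trans (nf M I h h₃ a)
      | succ b ih =>
        refine (h₂ (I.num a) (I.num b) I.zero).trans ?_
        rw [ih, num_pair h, num_pair h, ng M I h h₄]

/-! ### The sentence of a list of equations -/

/-- Conjunction. -/
def Formula.and (φ χ : Formula) : Formula := .neg (.imp φ (.neg χ))

/-- The conjunction of a list of equations and `0 ≠ s x₀`. -/
def matrix (E : List (Term × Term)) : Formula :=
  E.foldr (fun e φ => .and (.eq e.1 e.2) φ) (.neg (.eq .zero (.succ (.var 0))))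

/-- The universal closure of `matrix E`, prefixed by existential quantifiers. -/
def closure (Fs : List FnVar) (E : List (Term × Term)) : Formula :=
  Fs.foldr .exFn ([0, 1, 2].foldr .all (matrix E))

theorem quantifierFree_matrix (E : List (Term × Term)) : (matrix E).QuantifierFree := by
  induction E with
  | nil => simp [matrix, Formula.neg, Formula.QuantifierFree]
  | cons e E ih => exact ⟨⟨trivial, ih, trivial⟩, trivial⟩

theorem isExExFnAll_closure (Fs : List FnVar) (E : List (Term × Term)) :
    (closure Fs E).IsExExFnAll :=
  ⟨[], Fs, [0, 1, 2], matrix E, quantifierFree_matrix E, rfl⟩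

/-! ### Free variables of the closure -/

theorem freeVars_matrix {E : List (Term × Term)} (h : ThreeVars E) :
    (matrix E).freeVars ⊆ {0, 1, 2} := by
  induction E with
  | nil => simp [matrix, Formula.neg, Formula.freeVars, Term.succ, Term.vars]
  | cons e E ih =>
    obtain ⟨h₁, h₂⟩ := List.forall_mem_cons.1 h
    have := ih h₂
    rw [matrix] at this
    simp [matrix, Formula.and, Formula.neg, Formula.freeVars] at this h₁ ⊢
    exact ⟨h₁, this⟩

theorem freeRelVars_matrix (E : List (Term × Term)) : (matrix E).freeRelVars = ∅ := by
  induction E with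
  | nil => simp [matrix, Formula.neg, Formula.freeRelVars]
  | cons e E ih =>
    rw [matrix] at ih
    simp only [matrix, List.foldr_cons, Formula.and, Formula.neg, Formula.freeRelVars,
      Set.union_empty, Set.empty_union] at ih ⊢
    exact ih

/-- The function variables of a list of equations and of numerals. -/
def eqnFnVars (E : List (Term × Term)) : Set FnVar :=
  (Term.succ .zero).fnVars ∪ {F | ∃ e ∈ E, F ∈ e.1.fnVars ∪ e.2.fnVars}

theorem finite_eqnFnVars (E : List (Term × Term)) : (eqnFnVars E).Finite := by
  refine (Term.finite_fnVars _).union ?_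
  have : {F | ∃ e ∈ E, F ∈ e.1.fnVars ∪ e.2.fnVars} =
      ⋃ e ∈ {e | e ∈ E}, (e.1.fnVars ∪ e.2.fnVars) := by ext; simp
  rw [this]
  exact (List.finite_toSet E).biUnion fun e _ => e.1.finite_fnVars.union e.2.finite_fnVars

theorem freeFnVars_matrix (E : List (Term × Term)) : (matrix E).freeFnVars ⊆ eqnFnVars E := by
  induction E with
  | nil =>
    simp [matrix, Formula.neg, Formula.freeFnVars, eqnFnVars, Term.succ, Term.fnVars]
  | cons e E ih =>
    rw [matrix] at ih
    simp only [matrix, Formula.and, Formula.neg, Formula.freeFnVars, List.foldr_cons,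
      Set.union_empty]
    refine Set.union_subset ?_ (ih.trans ?_)
    · exact fun F hF => Or.inr ⟨e, List.mem_cons_self, hF⟩
    · exact Set.union_subset_union_right _ fun F ⟨e', he', h⟩ =>
        ⟨e', List.mem_cons_of_mem _ he', h⟩

theorem freeVars_foldr_exFn (Fs : List FnVar) (φ : Formula) :
    (Fs.foldr .exFn φ).freeVars = φ.freeVars := by
  induction Fs with
  | nil => rfl
  | cons F Fs ih => exact ih

theorem freeRelVars_foldr_exFn (Fs : List FnVar) (φ : Formula) :
    (Fs.foldr .exFn φ).freeRelVars = φ.freeRelVars := by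
  induction Fs with
  | nil => rfl
  | cons F Fs ih => exact ih

theorem freeFnVars_foldr_exFn (Fs : List FnVar) (φ : Formula) :
    (Fs.foldr .exFn φ).freeFnVars = φ.freeFnVars \ {F | F ∈ Fs} := by
  induction Fs with
  | nil => simp
  | cons F Fs ih =>
    simp only [List.foldr_cons, Formula.freeFnVars, ih]
    ext G
    simp only [Set.mem_sdiff, Set.mem_ofPred_eq, Set.mem_singleton_iff, List.mem_cons]
    tauto

theorem isSentence_closure {Fs : List FnVar} {E : List (Term × Term)} (hE : ThreeVars E)
    (hFs : eqnFnVars E ⊆ {F | F ∈ Fs}) : (closure Fs E).IsSentence := by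
  refine ⟨?_, ?_, ?_⟩
  · rw [closure, freeVars_foldr_exFn]
    simp only [List.foldr, Formula.all, Formula.neg, Formula.freeVars, Set.union_empty]
    ext x
    have : x ∈ (matrix E).freeVars → x ∈ _ := fun h => freeVars_matrix hE h
    simp only [Set.mem_insert_iff, Set.mem_singleton_iff] at this
    simp only [Set.mem_sdiff, Set.mem_singleton_iff, Set.mem_empty_iff_false]
    tauto
  · rw [closure, freeFnVars_foldr_exFn, Set.sdiff_eq_empty]
    simp only [List.foldr, Formula.all, Formula.neg, Formula.freeFnVars, Set.union_empty]
    exact (freeFnVars_matrix E).trans hFs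
  · rw [closure, freeRelVars_foldr_exFn]
    simp [Formula.all, Formula.neg, Formula.freeRelVars, freeRelVars_matrix]

/-! ### Truth and satisfiability of the closure -/

section

variable {M : Type}

theorem Formula.holds_neg {I : Interp M} {φ : Formula} : φ.neg.Holds I ↔ ¬ φ.Holds I := Iff.rfl

theorem Formula.holds_and {I : Interp M} {φ χ : Formula} :
    (φ.and χ).Holds I ↔ φ.Holds I ∧ χ.Holds I := by
  simp [Formula.and, Formula.neg, Formula.Holds]

theorem Formula.holds_all {I : Interp M} {x : ℕ} {φ : Formula} :
    (Formula.all x φ).Holds I ↔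
      ∀ a : M, φ.Holds { I with var := Function.update I.var x a } := by
  simp [Formula.all, Formula.neg, Formula.Holds]

theorem holds_matrix {I : Interp M} {E : List (Term × Term)} :
    (matrix E).Holds I ↔ (∀ e ∈ E, e.1.val I = e.2.val I) ∧
      I.zero ≠ I.app₁ (symb .succ) (I.var 0) := by
  induction E with
  | nil => simp [matrix, Formula.holds_neg, Formula.Holds, Term.succ]
  | cons e E ih =>
    rw [List.forall_mem_cons, and_assoc, ← ih]
    exact Formula.holds_and

theorem holds_foldr_all {I : Interp M} {E : List (Term × Term)} :
    ([0, 1, 2].foldr Formula.all (matrix E)).Holds I ↔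
      I.Models E ∧ ∀ a, I.zero ≠ I.app₁ (symb .succ) a := by
  have : ([0, 1, 2].foldr Formula.all (matrix E)).Holds I ↔
      ∀ a b c, (matrix E).Holds (I.assign a b c) := by
    simp only [List.foldr, Formula.holds_all]
    rfl
  simp only [this, holds_matrix, Interp.Models, Interp.assign_zero, Interp.assign_app₁,
    Interp.assign_var_zero]
  exact ⟨fun h => ⟨fun e he a b c => (h a b c).1 e he, fun a => (h a a a).2⟩,
    fun h a b c => ⟨fun e he => h.1 e he a b c, h.2 a⟩⟩

theorem exists_holds_of_holds_foldr_exFn {Fs : List FnVar} {φ : Formula} {I : Interp M}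
    (h : (Fs.foldr .exFn φ).Holds I) : ∃ J : Interp M, φ.Holds J := by
  induction Fs generalizing I with
  | nil => exact ⟨I, h⟩
  | cons F Fs ih =>
    obtain ⟨f, hf⟩ := h
    exact ih hf

theorem holds_foldr_exFn_of_holds {Fs : List FnVar} {φ : Formula} {I : Interp M}
    (h : φ.Holds I) : (Fs.foldr .exFn φ).Holds I := by
  induction Fs with
  | nil => exact h
  | cons F Fs ih => exact ⟨I.fn F, by simpa using ih⟩

end

/-- A structure already interprets the function variables, so the existential prefix does not affect
satisfiability. -/
theorem satisfiable_closure {Fs : List FnVar} {E : List (Term × Term)} :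
    (closure Fs E).Satisfiable ↔ ∃ (M : Type) (I : Interp M), I.Models E ∧
      ∀ a, I.zero ≠ I.app₁ (symb .succ) a := by
  simp only [← holds_foldr_all]
  exact ⟨fun ⟨M, I, h⟩ => ⟨M, exists_holds_of_holds_foldr_exFn h⟩,
    fun ⟨M, I, h⟩ => ⟨M, I, holds_foldr_exFn_of_holds h⟩⟩

/-! ### Computability of the Gödel numbers -/

theorem Term.primrec_code_app₁ {f : ℕ → Term} (i : ℕ) (hf : Primrec fun n => (f n).code) :
    Primrec fun n => (Term.app₁ i (f n)).code := by
  have : ∀ n, (Term.app₁ i (f n)).code =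
      Nat.pair 1 (Nat.pair (Nat.pair 1 i) (Encodable.encode [(f n).code])) := fun n => by
    simp [Term.app₁, Term.code]
  simp only [this]
  exact Primrec₂.natPair.comp (.const 1) (Primrec₂.natPair.comp (.const _)
    (Primrec.encode.comp (Primrec.list_cons.comp hf (.const []))))

theorem Term.primrec_code_app₂ {f g : ℕ → Term} (i : ℕ) (hf : Primrec fun n => (f n).code)
    (hg : Primrec fun n => (g n).code) : Primrec fun n => (Term.app₂ i (f n) (g n)).code := by
  have : ∀ n, (Term.app₂ i (f n) (g n)).code =
      Nat.pair 1 (Nat.pair (Nat.pair 2 i) (Encodable.encode [(f n).code, (g n).code])) :=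
    fun n => by simp [Term.app₂, Term.code]
  simp only [this]
  exact Primrec₂.natPair.comp (.const 1) (Primrec₂.natPair.comp (.const _)
    (Primrec.encode.comp (Primrec.list_cons.comp hf (Primrec.list_cons.comp hg (.const [])))))

theorem Term.primrec_code_num : Primrec fun n => (Term.num n).code := by
  have hstep : Primrec fun m : ℕ => Nat.pair 1 (Nat.pair (Nat.pair 1 (symb .succ))
      (Encodable.encode [m])) :=
    Primrec₂.natPair.comp (.const 1) (Primrec₂.natPair.comp (.const _)
      (Primrec.encode.comp (Primrec.list_cons.comp Primrec.id (.const []))))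
  refine (Primrec.nat_rec₁ Term.zero.code (hstep.comp (Primrec.snd (α := ℕ))).to₂).of_eq
    fun n => ?_
  induction n with
  | zero => rfl
  | succ n ih => simp [Term.num, Term.succ, Term.app₁, Term.code, ← ih]

theorem Formula.primrec_code_closure {E : ℕ → Term × Term} (Fs : List FnVar)
    (E' : List (Term × Term)) (h₁ : Primrec fun n => (E n).1.code)
    (h₂ : Primrec fun n => (E n).2.code) : Primrec fun n => (closure Fs (E n :: E')).code := by
  induction Fs with
  | nil =>
    simp only [closure, matrix, List.foldr, Formula.all, Formula.and, Formula.neg, Formula.code]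
    have hp {f : ℕ → ℕ} (a : ℕ) (hf : Primrec f) : Primrec fun n => Nat.pair a (f n) :=
      Primrec₂.natPair.comp (.const a) hf
    have hq {f : ℕ → ℕ} (a : ℕ) (hf : Primrec f) : Primrec fun n => Nat.pair (f n) a :=
      Primrec₂.natPair.comp hf (.const a)
    -- Each `Formula.all` unfolds to six pairings with constants.
    iterate 3 refine hp _ (hq _ (hp _ (hp _ (hp _ (hq _ ?_)))))
    exact hp _ (hq _ (hp _ (hq _ (hp _ (Primrec₂.natPair.comp h₁ h₂)))))
  | cons F Fs ih =>
    exact Primrec₂.natPair.comp (.const 5) (Primrec₂.natPair.comp (.const _) ih)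

/-! ### The reduction of the halting problem -/

theorem exists_reduction : ∃ φ : ℕ → Formula, Primrec (fun n => (φ n).code) ∧
    ∀ c : Code, (φ (Encodable.encode c)).IsSentence ∧ (φ (Encodable.encode c)).IsExExFnAll ∧
      ((φ (Encodable.encode c)).Satisfiable ↔ ¬ (c.eval 0).Dom) := by
  have hprim : Primrec fun m : ℕ =>
      Encodable.encode (Code.evaln m.unpair.1 (Denumerable.ofNat Code m.unpair.2) 0) :=
    Primrec.encode.comp (Code.primrec_evaln.comp (Primrec.pair (Primrec.pair
      (Primrec.fst.comp Primrec.unpair) ((Primrec.ofNat Code).comp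
        (Primrec.snd.comp Primrec.unpair))) (.const 0)))
  obtain ⟨g, E, hg, vE, mE, nE⟩ := exists_equations (Primrec.nat_iff.1 hprim)
  let eqn (n : ℕ) : Term × Term := (.app₁ (symb g) (.pair (.var 0) (.num n)), .zero)
  -- The list must not depend on the program; the numeral 1 already contains both zero and
  -- successor.
  let Fs := (finite_eqnFnVars (eqn 1 :: (arith ++ E))).toFinset.toList
  refine ⟨fun n => closure Fs (eqn n :: (arith ++ E)), ?_, fun c => ⟨?_, ?_, ?_⟩⟩
  · exact Formula.primrec_code_closure _ _ (Term.primrec_code_app₁ _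
      (Term.primrec_code_app₂ _ (.const _) Term.primrec_code_num)) (.const _)
  · refine isSentence_closure (List.forall_mem_cons.2
      ⟨by simp [eqn, Term.pair, Term.vars], threeVars_arith.append vE⟩) fun F hF => ?_
    have hF' : F ∈ eqnFnVars (eqn 1 :: (arith ++ E)) := by
      obtain hF | ⟨e, he, hF⟩ := hF
      · exact Or.inl hF
      obtain rfl | he := List.mem_cons.1 he
      · have : F ∈ (Term.num (Encodable.encode c)).fnVars → F ∈ _ :=
          fun h => Term.fnVars_num_subset _ h
        have hs : Term.num 1 = .succ .zero := rfl
        simp only [eqn, eqnFnVars, Term.pair, Term.fnVars_app₁, Term.fnVars_app₂, Set.mem_union,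
          List.exists_mem_cons_iff, Set.mem_ofPred_eq, hs] at hF this ⊢
        tauto
      · exact Or.inr ⟨e, List.mem_cons_of_mem _ he, hF⟩
    simpa [Fs] using hF'
  · exact isExExFnAll_closure _ _
  · rw [satisfiable_closure]
    constructor
    · rintro ⟨M, I, h, h0⟩ hdom
      obtain ⟨h₁, h₂⟩ := List.forall_mem_cons.1 h
      obtain ⟨h₂, h₃⟩ := Interp.models_append.1 h₂
      obtain ⟨k, hk⟩ := Code.evaln_complete.1 (Part.get_mem hdom)
      have hn := nE M I h₂ h₃ (Nat.pair k (Encodable.encode c))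
      have he := h₁ (I.num k) I.zero I.zero
      simp only [eqn, Term.pair, Term.val_app₁, Term.val_app₂, Term.val_var, Term.val_num,
        Term.val_zero, Interp.assign_app₁, Interp.assign_app₂, Interp.assign_var_zero,
        Interp.assign_num, Interp.assign_zero] at he
      rw [num_pair h₂, hn] at he
      -- `some m` is encoded by the successor of the code of `m`, so the right-hand numeral begins
      -- with s.
      simp only [Nat.unpair_pair, Denumerable.ofNat_encode, Option.mem_def.1 hk,
        Encodable.encode_some] at he
      exact h0 _ he.symm
    · intro hdom
      refine ⟨ℕ, std, List.forall_mem_cons.2 ⟨fun k _ _ => ?_,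
        Interp.models_append.2 ⟨std_models_arith, mE⟩⟩, fun a => by simp⟩
      -- `none` is encoded by 0, as the equation demands.
      have : Code.evaln k c 0 = none := by
        refine Option.eq_none_iff_forall_not_mem.2 fun m hm => hdom ?_
        exact Part.dom_iff_mem.2 ⟨m, Code.evaln_sound hm⟩
      simp [eqn, Term.pair, hg, this]

end UnsortedSO

theorem theorem2 :
    ¬ ∃ p : ℕ → Prop, ComputablePred p ∧
      ∀ φ : UnsortedSO.Formula, φ.IsSentence → φ.IsExExFnAll →
        (p φ.code ↔ φ.Satisfiable) := by
  rintro ⟨p, hp, h⟩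
  obtain ⟨φ, hφ, hred⟩ := UnsortedSO.exists_reduction
  refine ComputablePred.halting_problem 0 ?_
  have hcomp : ComputablePred fun c : Nat.Partrec.Code => p (φ (Encodable.encode c)).code :=
    ComputablePred.computable_of_manyOneReducible
      ⟨_, (hφ.comp Primrec.encode).to_comp, fun _ => Iff.rfl⟩ hp
  -- Satisfiability expresses non-halting, hence the complement.
  refine hcomp.not.of_eq fun c => ?_
  obtain ⟨h₁, h₂, h₃⟩ := hred c
  rw [h _ h₁ h₂, h₃, not_not]
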